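/- For $i=1,2$ let $(\mathbb S_i,d_i)$ be a complete separable metric space with its Borel $\sigma$-algebra, equipped with a continuous scalar multiplication $[0,\infty)\times\mathbb S_i\to\mathbb S_i$, $(\lambda,x)\mapsto\lambda x$, such that $\lambda_1(\lambda_2x)=(\lambda_1\lambda_2)x$ and $1x=x$. Let $\mathbb C_i\subset\mathbb S_i$ be a closed cone ($\lambda\mathbb C_i=\mathbb C_i$ for all $\lambda>0$), put $\mathbb O_i=\mathbb S_i\setminus\mathbb C_i$, and assume $d_i(\lambda_1x,\mathbb C_i)<d_i(\lambda_2x,\mathbb C_i)$ whenever $x\in\mathbb O_i$ and $0\le\lambda_1<\lambda_2$. Let $\mathcal S_{\mathbb O_i}$ be the family of Borel subsets of $\mathbb O_i$, and for $r>0$ let $\mathbb C_i^r=\{x\in\mathbb S_i:d_i(x,\mathbb C_i)<r\}$; a set $A\in\mathcal S_{\mathbb O_i}$ is bounded away from $\mathbb C_i$ if $A\cap\mathbb C_i^r=\emptyset$ for some $r>0$. Let $\mathbb M_{\mathbb O_i}$ be the set of measures on $\mathcal S_{\mathbb O_i}$ that are finite on $\mathbb S_i\setminus\mathbb C_i^r$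 for every $r>0$, with the $\sigma$-algebra generated by the sets $\{\upsilon:|\int f_j\,d\upsilon-\int f_j\,d\mu|<\varepsilon,\ j=1,\dots,k\}$, where $\mu\in\mathbb M_{\mathbb O_i}$, $\varepsilon>0$ and the $f_j$ are non-negative bounded continuous functions on $\mathbb O_i$ that vanish on $\mathbb C_i^r$ for some $r>0$. Let $\mathbb N_{\mathbb O_i}\subset\mathbb M_{\mathbb O_i}$ be the subspace of those $N$ for which $N(A\setminus\mathbb C_i^r)$ is a non-negative integer for all Borel $A$ and all $r>0$. A point process on $\mathbb O_i$ is a measurable map from a probability space $(\Omega,\mathcal A,P)$ to $\mathbb N_{\mathbb O_i}$. For $\mu\in\mathbb M_{\mathbb O_i}$, a point process $N$ is a Poisson random measure with mean measure $\mu$, written PRM$(\mu)$, if (i) for all $A\in\mathcal S_{\mathbb O_i}$ and integers $k\ge0$, $P(N(A)=k)=e^{-\mu(A)}\mu(A)^k/k!$ when $\mu(A)<\infty$ and $P(N(A)=k)=0$ when $\mu(A)=\infty$; and (ii) $N(A_1),\dots,N(A_k)$ are independent whenever $A_1,\dots,A_k\in\mathcal S_{\mathbb O_i}$ are pairwise disjoint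 and bounded away from $\mathbb C_i$. Let $T:\mathbb S_1\to\mathbb S_2$ be such that $T^{-1}(A)\in\mathcal S_{\mathbb O_1}$ for every $A\in\mathcal S_{\mathbb O_2}$, and suppose that for every $\varepsilon>0$ $$\inf\{d_1(x,\mathbb C_1): x\in\mathbb S_1,\ d_2(Tx,\mathbb C_2)>\varepsilon\}>0,$$ with $\inf\emptyset=\infty$. If $N$ is PRM$(\mu)$ on $\mathbb O_1$, then $\widetilde N=N\circ T^{-1}$, given by $\widetilde N(A)=N(T^{-1}A)$ for $A\in\mathcal S_{\mathbb O_2}$, is PRM$(\widetilde\mu)$ on $\mathbb O_2$ with $\widetilde\mu=\mu\circ T^{-1}$. If moreover $N=\sum_i\delta_{X_i}$, where the index set may be random, then $\widetilde N=\sum_i\delta_{TX_i}$ as measures on $\mathcal S_{\mathbb O_2}$ (points $TX_i\in\mathbb C_2$ contributing nothing). -/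

import Mathlib

open MeasureTheory ProbabilityTheory
open scoped NNReal ENNReal

namespace PoissonCone

/-- `C` is a closed cone for the scalar multiplication `[0,∞) × S → S` carried by `S`, and
scalar multiplication strictly increases the distance to `C` on the complement of `C`.
The algebraic laws `a • (b • x) = (a * b) • x`, `1 • x = x` and the joint continuity of the
multiplication are the classes `MulAction ℝ≥0 S` and `ContinuousSMul ℝ≥0 S`. -/
structure IsClosedCone {S : Type*} [MetricSpace S] [MulAction ℝ≥0 S] (C : Set S) : Prop where
  isClosed : IsClosed C
  smul_image : ∀ a : ℝ≥0, 0 < a → (fun x : S => a • x) '' C = C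
  dist_lt : ∀ x : S, x ∉ C → ∀ a b : ℝ≥0, a < b →
    Metric.infEDist (a • x) C < Metric.infEDist (b • x) C

/-- The open neighbourhood `C^r = {x | d(x, C) < r}`. -/
def nhd {S : Type*} [MetricSpace S] (C : Set S) (r : ℝ) : Set S :=
  {x | Metric.infEDist x C < ENNReal.ofReal r}

/-- A subset of `O = S \ C` is bounded away from `C` if it avoids some `C^r`, `r > 0`. -/
def BoundedAway {S : Type*} [MetricSpace S] (C : Set S) (A : Set ↥(Cᶜ)) : Prop :=
  ∃ r : ℝ, 0 < r ∧ ∀ x ∈ A, (x : S) ∉ nhd C r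

/-- Non-negative bounded continuous functions on `O = S \ C` that vanish on some `C^r`, `r > 0`. -/
def testFun {S : Type*} [MetricSpace S] (C : Set S) : Set (↥(Cᶜ) → ℝ) :=
  {f | Continuous f ∧ (∀ x, 0 ≤ f x) ∧ (∃ M : ℝ, ∀ x, f x ≤ M) ∧
    ∃ r : ℝ, 0 < r ∧ ∀ x : ↥(Cᶜ), (x : S) ∈ nhd C r → f x = 0}

/-- The space `M_O` of Borel measures on `O = S \ C` that are finite on the complement of
each `C^r`, `r > 0`. -/
def MO {S : Type*} [MetricSpace S] [MeasurableSpace S] (C : Set S) : Set (Measure ↥(Cᶜ)) :=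
  {μ | ∀ r : ℝ, 0 < r → μ {x | (x : S) ∉ nhd C r} < ∞}

/-- The σ-algebra on `M_O` generated by the neighbourhoods
`{υ | |∫ f_i dυ - ∫ f_i dμ| < ε, i = 1, …, k}`. -/
def sigmaMO {S : Type*} [MetricSpace S] [MeasurableSpace S] (C : Set S) :
    MeasurableSpace ↥(MO C) :=
  MeasurableSpace.generateFrom
    {B | ∃ (μ : ↥(MO C)) (ε : ℝ) (k : ℕ) (f : Fin k → ↥(Cᶜ) → ℝ),
      0 < ε ∧ (∀ i, f i ∈ testFun C) ∧
      B = {υ : ↥(MO C) | ∀ i, |∫ x, f i x ∂υ.1 - ∫ x, f i x ∂μ.1| < ε}}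

/-- The space `N_O` of counting measures: the members of `M_O` for which every Borel set
outside some `C^r`, `r > 0`, has a non-negative integer as its measure. -/
def NO {S : Type*} [MetricSpace S] [MeasurableSpace S] (C : Set S) : Set ↥(MO C) :=
  {N | ∀ r : ℝ, 0 < r → ∀ A : Set S, MeasurableSet A →
    ∃ n : ℕ, N.1 {x | (x : S) ∈ A \ nhd C r} = n}

/-- The σ-algebra on `N_O` as a subspace of `M_O`. -/
def sigmaNO {S : Type*} [MetricSpace S] [MeasurableSpace S] (C : Set S) :
    MeasurableSpace ↥(NO C) :=
  (sigmaMO C).comap Subtype.val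

/-- A point process on `O = S \ C`: a measurable map from `Ω` into `N_O`. -/
def IsPointProcess {Ω S : Type*} [MeasurableSpace Ω] [MetricSpace S] [MeasurableSpace S]
    (C : Set S) (N : Ω → Measure ↥(Cᶜ)) : Prop :=
  ∃ (hM : ∀ ω, N ω ∈ MO C) (hN : ∀ ω, (⟨N ω, hM ω⟩ : ↥(MO C)) ∈ NO C),
    @Measurable Ω ↥(NO C) _ (sigmaNO C) (fun ω => ⟨⟨N ω, hM ω⟩, hN ω⟩)

/-- `N` is a Poisson random measure on `O = S \ C` with mean measure `μ ∈ M_O`. -/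
structure IsPRM {Ω S : Type*} [MeasurableSpace Ω] [MetricSpace S] [MeasurableSpace S]
    (P : Measure Ω) (C : Set S) (μ : Measure ↥(Cᶜ)) (N : Ω → Measure ↥(Cᶜ)) : Prop where
  mean_mem : μ ∈ MO C
  pointProcess : IsPointProcess C N
  poisson : ∀ A : Set ↥(Cᶜ), MeasurableSet A → μ A < ∞ → ∀ k : ℕ,
    P {ω | N ω A = k} =
      ENNReal.ofReal (Real.exp (-(μ A).toReal) * (μ A).toReal ^ k / (Nat.factorial k : ℝ))
  poisson_top : ∀ A : Set ↥(Cᶜ), MeasurableSet A → μ A = ∞ → ∀ k : ℕ, P {ω | N ω A = k} = 0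
  indep : ∀ (k : ℕ) (A : Fin k → Set ↥(Cᶜ)), (∀ i, MeasurableSet (A i)) →
    (∀ i, BoundedAway C (A i)) → (∀ i j, i ≠ j → Disjoint (A i) (A j)) →
    iIndepFun (fun (i : Fin k) (ω : Ω) => N ω (A i)) P

/-- `T : S₁ → S₂` is measurable for the families of Borel subsets of `O₁ = S₁ \ C₁` and of
`O₂ = S₂ \ C₂`: the preimage of a Borel subset of `O₂` is a Borel subset of `O₁`. -/
def MeasurableOff {S₁ S₂ : Type*} [MeasurableSpace S₁] [MeasurableSpace S₂]
    (C₁ : Set S₁) (C₂ : Set S₂) (T : S₁ → S₂) : Prop :=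
  ∀ A : Set S₂, MeasurableSet A → A ⊆ C₂ᶜ → MeasurableSet (T ⁻¹' A) ∧ T ⁻¹' A ⊆ C₁ᶜ

/-- The trace on `O₁` of the preimage under `T` of a Borel set `A ⊆ O₂` is Borel. -/
theorem MeasurableOff.preimage {S₁ S₂ : Type*} [MeasurableSpace S₁] [MeasurableSpace S₂]
    {C₁ : Set S₁} {C₂ : Set S₂} {T : S₁ → S₂} (hT : MeasurableOff C₁ C₂ T)
    (hC₂ : MeasurableSet C₂) {A : Set ↥(C₂ᶜ)} (hA : MeasurableSet A) :
    MeasurableSet {x : ↥(C₁ᶜ) | T x ∈ (Subtype.val '' A : Set S₂)} :=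
  measurable_subtype_coe
    (hT _ (hC₂.compl.subtype_image hA) (by rintro _ ⟨y, _, rfl⟩; exact y.2)).1

/-- The image `μ ∘ T⁻¹` as a measure on `O₂ = S₂ \ C₂`, that is `A ↦ μ (T⁻¹ A)` for Borel
sets `A ⊆ O₂`. -/
noncomputable def image {S₁ S₂ : Type*} [MeasurableSpace S₁] [MeasurableSpace S₂]
    {C₁ : Set S₁} {C₂ : Set S₂} {T : S₁ → S₂} (hT : MeasurableOff C₁ C₂ T)
    (hC₂ : MeasurableSet C₂) (μ : Measure ↥(C₁ᶜ)) : Measure ↥(C₂ᶜ) :=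
  Measure.ofMeasurable (fun A _ => μ {x : ↥(C₁ᶜ) | T x ∈ (Subtype.val '' A : Set S₂)})
    (by simp)
    (by
      intro A hA hd
      rw [← measure_iUnion _ (fun i => hT.preimage hC₂ (hA i))]
      · congr 1
        ext x
        simp
      · intro i j hij
        refine Set.disjoint_left.2 ?_
        rintro x ⟨y, hy, hyx⟩ ⟨z, hz, hzx⟩
        have hyz : y = z := Subtype.ext (hyx.trans hzx.symm)
        exact Set.disjoint_left.1 (hd hij) hy (hyz ▸ hz))

theorem image_apply {S₁ S₂ : Type*} [MeasurableSpace S₁] [MeasurableSpace S₂]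
    {C₁ : Set S₁} {C₂ : Set S₂} {T : S₁ → S₂} (hT : MeasurableOff C₁ C₂ T)
    (hC₂ : MeasurableSet C₂) (μ : Measure ↥(C₁ᶜ)) {A : Set ↥(C₂ᶜ)} (hA : MeasurableSet A) :
    image hT hC₂ μ A = μ {x : ↥(C₁ᶜ) | T x ∈ (Subtype.val '' A : Set S₂)} :=
  Measure.ofMeasurable_apply A hA

/-- The measure `∑ i, δ_{x i}` on the Borel subsets of `O = S \ C`, for points `x i` of `S`;
points in `C` do not contribute. -/
noncomputable def pointSum {ι S : Type*} [MeasurableSpace S] (C : Set S) (x : ι → S) :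
    Measure ↥(Cᶜ) :=
  (Measure.sum fun i => Measure.dirac (x i)).comap Subtype.val

end PoissonCone

namespace PoissonCone

section ConeComplement

variable {S : Type*} [MetricSpace S] {C : Set S}

/-! Since `Ñ(A) = N(T⁻¹A)`, the Poisson laws and the independence of `Ñ` are those of `N` at
preimages, which stay disjoint. The separation condition (`exists_notMem_nhd_of_map`) keeps them
bounded away from `C₁`, which gives both independence and membership in `M_O`. The real work is
measurability: `T` need not be continuous, so composing a test function with `T` need not give a
test function. Instead, measurability into `N_O` is shown equivalent to measurability of every
evaluation `ω ↦ N ω A` (`IsPointProcess.measurable`, `isPointProcess_of_measurable`), and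
evaluations pull back trivially under `T`. -/

theorem isOpen_nhd (C : Set S) (r : ℝ) : IsOpen (nhd C r) :=
  isOpen_lt Metric.continuous_infEDist continuous_const

theorem nhd_mono (C : Set S) {r s : ℝ} (h : r ≤ s) : nhd C r ⊆ nhd C s :=
  fun _ hx => lt_of_lt_of_le hx (ENNReal.ofReal_le_ofReal h)

theorem subset_nhd (C : Set S) {r : ℝ} (hr : 0 < r) : C ⊆ nhd C r := fun x hx => by
  simpa [nhd, Metric.infEDist_zero_of_mem hx] using hr

theorem isClosed_compl_nhd (C : Set S) (r : ℝ) : IsClosed {x : ↥(Cᶜ) | (x : S) ∉ nhd C r} :=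
  ((isOpen_nhd C r).preimage continuous_subtype_val).isClosed_compl

/-- A point outside a closed set `C` lies outside some neighbourhood `C^{1/(n+1)}`. -/
theorem exists_notMem_nhd (hC : IsClosed C) {x : S} (hx : x ∉ C) :
    ∃ n : ℕ, x ∉ nhd C (1 / (n + 1 : ℝ)) := by
  have hpos : 0 < Metric.infEDist x C := by
    rw [Metric.infEDist_pos_iff_notMem_closure, hC.closure_eq]
    exact hx
  obtain ⟨r, hr, hrx⟩ := ENNReal.lt_iff_exists_real_btwn.1 hpos
  have hr0 : 0 < r := ENNReal.ofReal_pos.1 hrx.1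
  obtain ⟨n, hn⟩ := exists_nat_one_div_lt hr0
  refine ⟨n, fun h => ?_⟩
  exact absurd (nhd_mono C hn.le h) (not_lt.2 hrx.2.le)

/-- A point within `r / 2` of `C` and within `δ ≤ r / 2` of some `z ∈ F` would put `z` in `C^r`. -/
theorem thickenedIndicator_eq_zero_of_mem_nhd {F : Set ↥(Cᶜ)} {r δ : ℝ} (hδ : 0 < δ)
    (hδr : δ ≤ r / 2) (hF : ∀ x ∈ F, (x : S) ∉ nhd C r) {x : ↥(Cᶜ)}
    (hx : (x : S) ∈ nhd C (r / 2)) : thickenedIndicator hδ F x = 0 := by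
  refine thickenedIndicator_zero hδ F fun h => ?_
  obtain ⟨z, hz, hxz⟩ := (Metric.mem_thickening_iff_exists_edist_lt _ _).1 h
  apply hF z hz
  have h2 : edist (z : S) (x : S) < ENNReal.ofReal δ := by
    rw [edist_comm]; exact hxz
  change Metric.infEDist (z : S) C < ENNReal.ofReal r
  calc Metric.infEDist (z : S) C ≤ Metric.infEDist (x : S) C + edist (z : S) (x : S) :=
        Metric.infEDist_le_infEDist_add_edist
    _ < ENNReal.ofReal (r / 2) + ENNReal.ofReal δ := ENNReal.add_lt_add hx h2
    _ = ENNReal.ofReal (r / 2 + δ) := (ENNReal.ofReal_add (by linarith) hδ.le).symm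
    _ ≤ ENNReal.ofReal r := ENNReal.ofReal_le_ofReal (by linarith)

/-- The thickened indicator of a set avoiding `C^r` is a test function as soon as the
thickening radius is at most `r / 2`. -/
theorem thickenedIndicator_mem_testFun {F : Set ↥(Cᶜ)} {r δ : ℝ} (hδ : 0 < δ) (hδr : δ ≤ r / 2)
    (hF : ∀ x ∈ F, (x : S) ∉ nhd C r) :
    (fun x => (thickenedIndicator hδ F x : ℝ)) ∈ testFun C := by
  refine ⟨NNReal.continuous_coe.comp (thickenedIndicator hδ F).continuous,
    fun x => NNReal.coe_nonneg _, ⟨1, fun x => ?_⟩, r / 2, by linarith, fun x hx => ?_⟩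
  · exact_mod_cast thickenedIndicator_le_one hδ F x
  · exact NNReal.coe_eq_zero.2 (thickenedIndicator_eq_zero_of_mem_nhd hδ hδr hF hx)

variable [MeasurableSpace S]

/-- The integral of a test function is a measurable function on `M_O`. -/
theorem measurable_integral_sigmaMO {f : ↥(Cᶜ) → ℝ} (hf : f ∈ testFun C) :
    @Measurable _ _ (sigmaMO C) _ (fun υ : ↥(MO C) => ∫ x, f x ∂υ.1) := by
  let := sigmaMO C
  refine measurable_of_Iio fun ε => ?_
  have h0 : ∀ υ : ↥(MO C), 0 ≤ ∫ x, f x ∂υ.1 := fun υ => integral_nonneg hf.2.1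
  rcases le_or_gt ε 0 with hε | hε
  · convert MeasurableSet.empty
    ext υ
    simpa using hε.trans (h0 υ)
  -- Centred at the zero measure, the generating neighbourhood is `{∫ f < ε}`.
  · refine MeasurableSpace.measurableSet_generateFrom
      ⟨⟨0, fun r _ => by simp⟩, ε, 1, fun _ => f, hε, fun _ => hf, ?_⟩
    ext υ
    simp [abs_of_nonneg (h0 υ)]

variable [BorelSpace S]

/-- A bounded continuous function that vanishes near `C` is integrable against members of
`M_O`. -/
theorem integrable_of_mem_testFun {f : ↥(Cᶜ) → ℝ} (hf : f ∈ testFun C)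
    {υ : Measure ↥(Cᶜ)} (hυ : υ ∈ MO C) : Integrable f υ := by
  obtain ⟨hc, h0, ⟨M, hM⟩, r, hr, hfr⟩ := hf
  have hsupp : Function.support f ⊆ {x : ↥(Cᶜ) | (x : S) ∉ nhd C r} :=
    fun x hx hxr => hx (hfr x hxr)
  rw [← integrableOn_iff_integrable_of_support_subset hsupp]
  refine Measure.integrableOn_of_bounded (M := M) (hυ r hr).ne hc.aestronglyMeasurable ?_
  exact Filter.Eventually.of_forall fun x => by
    rw [Real.norm_of_nonneg (h0 x)]; exact hM x

/-- A point process is measurable for the canonical `σ`-algebra on the space of measures. -/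
theorem IsPointProcess.measurable {Ω : Type*} [MeasurableSpace Ω] (hC : IsClosed C)
    {N : Ω → Measure ↥(Cᶜ)} (hN : IsPointProcess C N) : Measurable N := by
  obtain ⟨hM, _, hmeas⟩ := hN
  have hint : ∀ f ∈ testFun C, Measurable fun ω => ∫ x, f x ∂N ω := fun f hf => by
    let := sigmaMO C
    let := sigmaNO C
    exact (measurable_integral_sigmaMO hf).comp
      ((comap_measurable (Subtype.val : ↥(NO C) → ↥(MO C))).comp hmeas)
  have hclosed : ∀ r : ℝ, 0 < r → ∀ F : Set ↥(Cᶜ), IsClosed F →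
      (∀ x ∈ F, (x : S) ∉ nhd C r) → Measurable fun ω => N ω F := by
    intro r hr F hF hFr
    obtain ⟨δ, -, hδ, hlim⟩ := exists_seq_strictAnti_tendsto' (half_pos hr)
    have htest := fun n => thickenedIndicator_mem_testFun (hδ n).1 (hδ n).2.le hFr
    have hgm : ∀ n, Measurable fun ω => ∫⁻ x, (thickenedIndicator (hδ n).1 F x : ℝ≥0∞) ∂N ω := by
      intro n
      convert (hint _ (htest n)).ennreal_ofReal using 2 with ω
      rw [ofReal_integral_eq_lintegral_ofReal (integrable_of_mem_testFun (htest n) (hM ω))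
        (Filter.Eventually.of_forall fun x => NNReal.coe_nonneg _)]
      simp only [ENNReal.ofReal_coe_nnreal]
    refine measurable_of_tendsto_metrizable hgm (tendsto_pi_nhds.2 fun ω => ?_)
    -- `N ω` may be infinite near `C`. All the thickened indicators vanish on `C^(r/2)`, so
    -- restricting to `R` makes the measure finite without changing any integral.
    set R : Set ↥(Cᶜ) := {x | (x : S) ∉ nhd C (r / 2)}
    have : IsFiniteMeasure ((N ω).restrict R) :=
      isFiniteMeasure_restrict.2 (hM ω (r / 2) (half_pos hr)).ne
    have hlint : ∀ n, ∫⁻ x, (thickenedIndicator (hδ n).1 F x : ℝ≥0∞) ∂(N ω).restrict R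
        = ∫⁻ x, (thickenedIndicator (hδ n).1 F x : ℝ≥0∞) ∂N ω := fun n => by
      refine setLIntegral_eq_of_support_subset fun x hx hxr => hx ?_
      exact ENNReal.coe_eq_zero.2
        (thickenedIndicator_eq_zero_of_mem_nhd (hδ n).1 (hδ n).2.le hFr hxr)
    have hFR : (N ω).restrict R F = N ω F := by
      refine Measure.restrict_eq_self _ fun x hx hxr => hFr x hx (nhd_mono C (by linarith) hxr)
    have := tendsto_lintegral_thickenedIndicator_of_isClosed ((N ω).restrict R) hF
      (fun n => (hδ n).1) hlim
    simpa only [hlint, hFR] using this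
  -- Closed sets of finite measure exhausting `O`: on each, the π-system of closed sets determines
  -- measurability, and continuity from below removes the restriction.
  let R : ℕ → Set ↥(Cᶜ) := fun n => {x | (x : S) ∉ nhd C (1 / (n + 1 : ℝ))}
  have hRc : ∀ n, IsClosed (R n) := fun n => isClosed_compl_nhd C _
  have hRpos : ∀ n : ℕ, (0 : ℝ) < 1 / (n + 1 : ℝ) := fun n => by positivity
  have hRmono : Monotone R := fun m n hmn x hx hxn =>
    hx (nhd_mono C (one_div_le_one_div_of_le (by positivity) (by gcongr)) hxn)
  have hRU : ⋃ n, R n = Set.univ := Set.eq_univ_of_forall fun x =>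
    Set.mem_iUnion.2 (exists_notMem_nhd hC x.2)
  have hrestrict : ∀ n, Measurable fun ω => (N ω).restrict (R n) := fun n => by
    have : ∀ ω, IsFiniteMeasure ((N ω).restrict (R n)) := fun ω =>
      isFiniteMeasure_restrict.2 (hM ω _ (hRpos n)).ne
    have key : ∀ F : Set ↥(Cᶜ), IsClosed F →
        Measurable fun ω => (N ω).restrict (R n) F := fun F hF => by
      simp only [Measure.restrict_apply hF.measurableSet]
      exact hclosed _ (hRpos n) _ (hF.inter (hRc n)) fun x hx => hx.2
    refine Measurable.measure_of_isPiSystem ?_ isPiSystem_isClosed key (key _ isClosed_univ)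
    rw [BorelSpace.measurable_eq (α := ↥(Cᶜ)), borel_eq_generateFrom_isClosed]
  refine Measure.measurable_of_measurable_coe _ fun A hA => ?_
  have hsup : ∀ ω, N ω A = ⨆ n, (N ω).restrict (R n) A := fun ω => by
    simp only [Measure.restrict_apply hA]
    have hmono : Monotone fun n => A ∩ R n := fun _ _ h => Set.inter_subset_inter_right A (hRmono h)
    rw [← hmono.measure_iUnion, ← Set.inter_iUnion, hRU, Set.inter_univ]
  simp only [hsup]
  exact Measurable.iSup fun n => (Measure.measurable_coe hA).comp (hrestrict n)

/-- A measurable family of counting measures is a point process. -/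
theorem isPointProcess_of_measurable {Ω : Type*} [MeasurableSpace Ω] {N : Ω → Measure ↥(Cᶜ)}
    (hM : ∀ ω, N ω ∈ MO C) (hI : ∀ ω, (⟨N ω, hM ω⟩ : ↥(MO C)) ∈ NO C) (hN : Measurable N) :
    IsPointProcess C N := by
  refine ⟨hM, hI, ?_⟩
  let := sigmaMO C
  rw [sigmaNO, measurable_comap_iff]
  refine measurable_generateFrom ?_
  rintro _ ⟨υ, ε, k, f, -, hf, rfl⟩
  have hint : ∀ i, Measurable fun ω => ∫ x, f i x ∂N ω := fun i => by
    have hmeas : Measurable (f i) := (hf i).1.measurable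
    simp only [integral_eq_lintegral_of_nonneg_ae (Filter.Eventually.of_forall (hf i).2.1)
      hmeas.aestronglyMeasurable]
    exact ((Measure.measurable_lintegral hmeas.ennreal_ofReal).comp hN).ennreal_toReal
  have hset : ∀ i, MeasurableSet {ω | |∫ x, f i x ∂N ω - ∫ x, f i x ∂υ.1| < ε} := fun i =>
    measurableSet_lt ((hint i).sub_const _).abs measurable_const
  convert MeasurableSet.iInter hset
  ext ω
  simp

end ConeComplement

section Image

variable {S₁ S₂ : Type*} [MeasurableSpace S₁] [MeasurableSpace S₂]
  {C₁ : Set S₁} {C₂ : Set S₂} {T : S₁ → S₂}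

theorem measurable_image (hT : MeasurableOff C₁ C₂ T) (hC₂ : MeasurableSet C₂) :
    Measurable (image hT hC₂) := by
  refine Measure.measurable_of_measurable_coe _ fun A hA => ?_
  simp only [image_apply hT hC₂ _ hA]
  exact Measure.measurable_coe (hT.preimage hC₂ hA)

theorem pointSum_apply {ι : Type*} (hC₁ : MeasurableSet C₁) (x : ι → S₁) {A : Set ↥(C₁ᶜ)}
    (hA : MeasurableSet A) :
    pointSum C₁ x A = ∑' i, (Subtype.val '' A).indicator (1 : S₁ → ℝ≥0∞) (x i) := by
  have hA' : MeasurableSet (Subtype.val '' A : Set S₁) := hC₁.compl.subtype_image hA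
  rw [pointSum, Measure.comap_apply _ Subtype.val_injective
    (fun s hs => hC₁.compl.subtype_image hs) _ hA, Measure.sum_apply _ hA']
  simp only [Measure.dirac_apply' _ hA']

/-- `MeasurableOff` forces `T ⁻¹' A ⊆ C₁ᶜ` for Borel `A ⊆ C₂ᶜ`, so the points in `C₁` that the first
sum drops would not count in the second either. -/
theorem image_pointSum {ι : Type*} (hT : MeasurableOff C₁ C₂ T) (hC₁ : MeasurableSet C₁)
    (hC₂ : MeasurableSet C₂) (x : ι → S₁) :
    image hT hC₂ (pointSum C₁ x) = pointSum C₂ fun i => T (x i) := by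
  ext A hA
  rw [image_apply hT hC₂ _ hA, pointSum_apply hC₁ _ (hT.preimage hC₂ hA), pointSum_apply hC₂ _ hA]
  have hsub : T ⁻¹' (Subtype.val '' A : Set S₂) ⊆ C₁ᶜ :=
    (hT _ (hC₂.compl.subtype_image hA) (by rintro _ ⟨y, _, rfl⟩; exact y.2)).2
  have himg : (Subtype.val '' {y : ↥(C₁ᶜ) | T y ∈ (Subtype.val '' A : Set S₂)} : Set S₁)
      = T ⁻¹' (Subtype.val '' A) := by
    ext y
    exact ⟨by rintro ⟨z, hz, rfl⟩; exact hz, fun hy => ⟨⟨y, hsub hy⟩, hy, rfl⟩⟩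
  rw [himg]
  rfl

end Image

section BoundedAway

variable {S₁ S₂ : Type*} [MetricSpace S₁] [MetricSpace S₂]
  {C₁ : Set S₁} {C₂ : Set S₂} {T : S₁ → S₂}

/-- Under the separation condition, points mapped outside `C₂^r` stay outside some `C₁^δ`. -/
theorem exists_notMem_nhd_of_map (haway : ∀ ε : ℝ, 0 < ε →
      0 < ⨅ x ∈ {x : S₁ | ENNReal.ofReal ε < Metric.infEDist (T x) C₂}, Metric.infEDist x C₁)
    {r : ℝ} (hr : 0 < r) : ∃ δ : ℝ, 0 < δ ∧ ∀ x, T x ∉ nhd C₂ r → x ∉ nhd C₁ δ := by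
  -- Avoiding `C₂^r` only gives distance `≥ r`, while the hypothesis needs `> ε`; hence `ε = r / 2`.
  -- A real `δ` below the infimum exists even when that infimum is `∞`.
  obtain ⟨δ, -, hδ, hlt⟩ := ENNReal.lt_iff_exists_real_btwn.1 (haway (r / 2) (half_pos hr))
  refine ⟨δ, ENNReal.ofReal_pos.1 hδ, fun x hx => not_lt.2 (hlt.le.trans (iInf₂_le x ?_))⟩
  exact ((ENNReal.ofReal_lt_ofReal_iff hr).2 (half_lt_self hr)).trans_le (not_lt.1 hx)

end BoundedAway

end PoissonCone

theorem proposition4p3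
    {S₁ S₂ Ω : Type*}
    [MetricSpace S₁] [CompleteSpace S₁] [TopologicalSpace.SeparableSpace S₁]
    [MeasurableSpace S₁] [BorelSpace S₁] [MulAction ℝ≥0 S₁] [ContinuousSMul ℝ≥0 S₁]
    [MetricSpace S₂] [CompleteSpace S₂] [TopologicalSpace.SeparableSpace S₂]
    [MeasurableSpace S₂] [BorelSpace S₂] [MulAction ℝ≥0 S₂] [ContinuousSMul ℝ≥0 S₂]
    (C₁ : Set S₁) (C₂ : Set S₂)
    (hC₁ : PoissonCone.IsClosedCone C₁) (hC₂ : PoissonCone.IsClosedCone C₂)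
    (T : S₁ → S₂) (hT : PoissonCone.MeasurableOff C₁ C₂ T)
    (haway : ∀ ε : ℝ, 0 < ε →
      0 < ⨅ x ∈ {x : S₁ | ENNReal.ofReal ε < Metric.infEDist (T x) C₂}, Metric.infEDist x C₁)
    [MeasurableSpace Ω] (P : Measure Ω) [IsProbabilityMeasure P]
    (μ : Measure ↥(C₁ᶜ)) (N : Ω → Measure ↥(C₁ᶜ))
    (hN : PoissonCone.IsPRM P C₁ μ N) :
    PoissonCone.IsPRM P C₂ (PoissonCone.image hT hC₂.isClosed.measurableSet μ)
        (fun ω => PoissonCone.image hT hC₂.isClosed.measurableSet (N ω)) ∧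
      ∀ (ι : Type*) (I : Ω → Set ι) (X : ι → Ω → S₁) (ω : Ω),
        N ω = PoissonCone.pointSum C₁ (fun i : ↥(I ω) => X i ω) →
        PoissonCone.image hT hC₂.isClosed.measurableSet (N ω) =
          PoissonCone.pointSum C₂ (fun i : ↥(I ω) => T (X i ω)) := by
  have hmC₁ : MeasurableSet C₁ := hC₁.isClosed.measurableSet
  have hmC₂ : MeasurableSet C₂ := hC₂.isClosed.measurableSet
  have hMO : ∀ υ ∈ PoissonCone.MO C₁, PoissonCone.image hT hmC₂ υ ∈ PoissonCone.MO C₂ := by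
    intro υ hυ r hr
    obtain ⟨δ, hδ, hδr⟩ := PoissonCone.exists_notMem_nhd_of_map haway hr
    rw [PoissonCone.image_apply hT hmC₂ _ (PoissonCone.isClosed_compl_nhd C₂ r).measurableSet]
    refine (measure_mono ?_).trans_lt (hυ δ hδ)
    rintro x ⟨y, hy, hyx⟩
    exact hδr x (hyx ▸ hy)
  refine ⟨⟨hMO μ hN.mean_mem, ?_, ?_, ?_, ?_⟩, ?_⟩
  · have hNm := hN.pointProcess.measurable hC₁.isClosed
    obtain ⟨hM, hI, -⟩ := hN.pointProcess
    refine PoissonCone.isPointProcess_of_measurable (fun ω => hMO _ (hM ω)) (fun ω r hr A hA => ?_)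
      ((PoissonCone.measurable_image hT hmC₂).comp hNm)
    obtain ⟨δ, hδ, hδr⟩ := PoissonCone.exists_notMem_nhd_of_map haway hr
    have hB : MeasurableSet (A \ PoissonCone.nhd C₂ r) :=
      hA.diff (PoissonCone.isOpen_nhd C₂ r).measurableSet
    have hBC : A \ PoissonCone.nhd C₂ r ⊆ C₂ᶜ := fun y hy hyC =>
      hy.2 (PoissonCone.subset_nhd C₂ hr hyC)
    -- Removing `C₁^δ` from the preimage removes nothing, so integrality of `N ω` applies to the
    -- whole preimage.
    obtain ⟨n, hn⟩ := hI ω δ hδ _ (hT _ hB hBC).1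
    refine ⟨n, ?_⟩
    have hBm : MeasurableSet {y : ↥(C₂ᶜ) | (y : S₂) ∈ A \ PoissonCone.nhd C₂ r} :=
      measurable_subtype_coe hB
    change PoissonCone.image hT hmC₂ (N ω) _ = _
    rw [PoissonCone.image_apply hT hmC₂ _ hBm, ← hn]
    congr 1
    ext x
    constructor
    · rintro ⟨y, hy, hyx⟩
      have hx : T x ∈ A \ PoissonCone.nhd C₂ r := hyx ▸ hy
      exact ⟨hx, hδr x hx.2⟩
    · exact fun hx => ⟨⟨T x, hBC hx.1⟩, hx.1, rfl⟩
  · intro A hA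
    simp only [PoissonCone.image_apply hT hmC₂ _ hA]
    exact hN.poisson _ (hT.preimage hmC₂ hA)
  · intro A hA
    simp only [PoissonCone.image_apply hT hmC₂ _ hA]
    exact hN.poisson_top _ (hT.preimage hmC₂ hA)
  · intro k A hA hAway hdisj
    simp only [PoissonCone.image_apply hT hmC₂ _ (hA _)]
    refine hN.indep k _ (fun i => hT.preimage hmC₂ (hA i)) (fun i => ?_) fun i j hij => ?_
    · obtain ⟨r, hr, hAr⟩ := hAway i
      obtain ⟨δ, hδ, hδr⟩ := PoissonCone.exists_notMem_nhd_of_map haway hr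
      refine ⟨δ, hδ, ?_⟩
      rintro x ⟨y, hy, hyx⟩
      exact hδr x (hyx ▸ hAr y hy)
    · refine Set.disjoint_left.2 ?_
      rintro x ⟨y, hy, hyx⟩ ⟨z, hz, hzx⟩
      obtain rfl : y = z := Subtype.ext (hyx.trans hzx.symm)
      exact Set.disjoint_left.1 (hdisj i j hij) hy hz
  · intro ι I X ω hω
    rw [hω]
    exact PoissonCone.image_pointSum hT hmC₁ hmC₂ _
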